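/- **Definitions.** Let $G$ be a finitely generated group, endowed with the word metric $\mathrm{dist}$ of a finite generating set (the notions below do not depend on the choice of this set, except for the value of $M$). * For a non-principal ultrafilter $\omega$ on $\mathbb N$, positive reals $d=(d_n)$ with $\lim_\omega d_n=\infty$ and points $b=(b_n)$ of $G$, the asymptotic cone $\mathrm{Cone}_\omega(G,b,d)$ is the set of sequences $y=(y_n)$ in $G$ with $\lim_\omega \mathrm{dist}(y_n,b_n)/d_n<\infty$, modulo $y\sim z$ iff $\lim_\omega \mathrm{dist}(y_n,z_n)/d_n=0$, with the metric $\lim_\omega \mathrm{dist}(y_n,z_n)/d_n$. A cut-point of a space is a point whose complement is not connected; the point of a one-point space counts as a cut-point. * $G$ is *unconstricted* if (1) there are $\omega$ and $d$ as above such that for every $b$ the cone $\mathrm{Cone}_\omega(G,b,d)$ has no cut-points, and (2) there is a constant $c$ such that every element of $G$ is at distance at most $c$ from a bi-infinite geodesic (an isometric embedding $\mathbb Z\to G$). * A finitely generated subgroup $H\le G$ is *undistorted* if its word metrics are bi-Lipschitz equivalent to the restriction to $H$ of the word metric of $G$. * For $M>0$ and a finite non-empty collection $\mathcal H$ of subgroups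 of $G$, the group $G$ is an *$M$-algebraic network* with respect to $\mathcal H$ if: all $H\in\mathcal H$ are finitely generated and undistorted in $G$; there is a finite index subgroup $G_1\le G$ such that every element of $G$ is at distance less than $M$ from $G_1$ and some finite generating set of $G_1$ is contained in $\bigcup_{H\in\mathcal H}H$; and any $H,H'\in\mathcal H$ are joined by a finite sequence $H=H_1,\dots,H_k=H'$ in $\mathcal H$ with $H_i\cap H_{i+1}$ infinite for all $1\le i<k$. * $G$ is *algebraically thick of order at most $1$* if for some $M>0$ it is an $M$-algebraic network with respect to some finite non-empty collection $\mathcal H$ of unconstricted subgroups. * Let $m_{ij}=m_{ji}\in\{2,3,\dots,\infty\}$ for $i\ne j$ in $\{1,\dots,n\}$. The associated *Artin group* is $A=\langle x_1,\dots,x_n \mid (x_i,x_j)_{m_{ij}}=(x_j,x_i)_{m_{ij}} \text{ for } i\neq j,\ m_{ij}<\infty\rangle$, where $(x,y)_m=xyx\cdots$ ($m$ factors). Its *presentation graph* has vertices $1,\dots,n$, with $i\neq j$ adjacent iff $m_{ij}<\infty$. The Artin group is *even* if every $m_{ij}$ is an even integer or $\infty$. **Theorem.** Every even Artin group with at least two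 generators and connected presentation graph is algebraically thick of order at most $1$. -/

import Mathlib

open Filter Topology

/-! ### Word metrics -/

/-- A finite generating set of a group. -/
structure FinGenSet (G : Type*) [Group G] where
  gens : Finset G
  closure_eq_top : Subgroup.closure (gens : Set G) = ⊤

/-- The word length of `g` with respect to `S`: the least length of a word in the letters of
`S` and their inverses that represents `g`. -/
noncomputable def FinGenSet.length {G : Type*} [Group G] (S : FinGenSet G) (g : G) : ℕ :=
  sInf {n | ∃ l : List G, (∀ s ∈ l, s ∈ S.gens ∨ s⁻¹ ∈ S.gens) ∧ l.prod = g ∧ l.length = n}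

theorem FinGenSet.exists_word {G : Type*} [Group G] (S : FinGenSet G) (g : G) :
    ∃ l : List G, (∀ s ∈ l, s ∈ S.gens ∨ s⁻¹ ∈ S.gens) ∧ l.prod = g ∧ l.length = S.length g := by
  have hne : {n | ∃ l : List G, (∀ s ∈ l, s ∈ S.gens ∨ s⁻¹ ∈ S.gens) ∧ l.prod = g ∧
      l.length = n}.Nonempty := by
    have hg : g ∈ (Subgroup.closure (S.gens : Set G)).toSubmonoid := by
      rw [S.closure_eq_top]; exact Subgroup.mem_top g
    rw [Subgroup.closure_toSubmonoid] at hg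
    obtain ⟨l, hl, hp⟩ := Submonoid.exists_list_of_mem_closure hg
    exact ⟨l.length, l, fun s hs => by simpa using hl s hs, hp, rfl⟩
  exact Nat.sInf_mem hne

theorem FinGenSet.length_le {G : Type*} [Group G] (S : FinGenSet G) (l : List G)
    (hl : ∀ s ∈ l, s ∈ S.gens ∨ s⁻¹ ∈ S.gens) : S.length l.prod ≤ l.length :=
  Nat.sInf_le ⟨l, hl, rfl, rfl⟩

theorem FinGenSet.length_one {G : Type*} [Group G] (S : FinGenSet G) : S.length 1 = 0 := by
  have h := S.length_le [] (by simp)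
  simpa using h

theorem FinGenSet.length_mul_le {G : Type*} [Group G] (S : FinGenSet G) (g h : G) :
    S.length (g * h) ≤ S.length g + S.length h := by
  obtain ⟨l, hl, rfl, hll⟩ := S.exists_word g
  obtain ⟨k, hk, rfl, hkk⟩ := S.exists_word h
  rw [← hll, ← hkk, ← List.prod_append, ← List.length_append]
  refine S.length_le _ fun s hs => ?_
  rcases List.mem_append.1 hs with hs | hs
  · exact hl s hs
  · exact hk s hs

theorem FinGenSet.length_inv_le {G : Type*} [Group G] (S : FinGenSet G) (g : G) :
    S.length g⁻¹ ≤ S.length g := by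
  obtain ⟨l, hl, rfl, hll⟩ := S.exists_word g
  rw [← hll, List.prod_inv_reverse]
  have h := S.length_le (l.map fun x => x⁻¹).reverse (fun s hs => by
    simp only [List.mem_reverse, List.mem_map] at hs
    obtain ⟨t, ht, rfl⟩ := hs
    simpa [or_comm] using hl t ht)
  simpa using h

theorem FinGenSet.length_inv {G : Type*} [Group G] (S : FinGenSet G) (g : G) :
    S.length g⁻¹ = S.length g :=
  le_antisymm (S.length_inv_le g) (by simpa using S.length_inv_le g⁻¹)

theorem FinGenSet.eq_one_of_length {G : Type*} [Group G] (S : FinGenSet G) {g : G}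
    (h : S.length g = 0) : g = 1 := by
  obtain ⟨l, -, rfl, hll⟩ := S.exists_word g
  rw [h, List.length_eq_zero_iff] at hll
  simp [hll]

/-- The underlying set of `G`, regarded as a metric space with the word metric of `S`. -/
def WordSpace {G : Type*} [Group G] (_S : FinGenSet G) : Type _ := G

/-- The word metric `dist g h = |g⁻¹ h|_S`. -/
noncomputable instance {G : Type*} [Group G] (S : FinGenSet G) : MetricSpace (WordSpace S) where
  dist := fun (g h : G) => (S.length (g⁻¹ * h) : ℝ)
  dist_self := fun (g : G) => by
    simp [S.length_one]
  dist_comm := fun (g h : G) => by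
    rw [← S.length_inv (g⁻¹ * h)]
    simp
  dist_triangle := fun (g h k : G) => by
    have := S.length_mul_le (g⁻¹ * h) (h⁻¹ * k)
    rw [show g⁻¹ * h * (h⁻¹ * k) = g⁻¹ * k by group] at this
    exact_mod_cast this
  eq_of_dist_eq_zero := fun {g h : G} hgh => by
    change ((S.length (g⁻¹ * h) : ℕ) : ℝ) = 0 at hgh
    have := S.eq_one_of_length (by exact_mod_cast hgh)
    exact inv_mul_eq_one (G := G).1 this

/-! ### Asymptotic cones -/

/-- A non-principal ultrafilter `ω` on `ℕ`, with a sequence of positive scaling constants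
`d n` such that `lim_ω d n = ∞`. -/
structure ConeScale where
  ω : Ultrafilter ℕ
  nonprincipal : ∀ s ∈ ω, s.Infinite
  d : ℕ → ℝ
  d_pos : ∀ n, 0 < d n
  tendsto_d : Tendsto d ω atTop

/-- The sequences at finite `ω`-distance from the sequence of observation points `b`, where the
metric on the `n`-th factor is `dist / d n`. -/
def PreCone (X : Type*) [MetricSpace X] (σ : ConeScale) (b : ℕ → X) : Type _ :=
  {y : ℕ → X // ∃ C : ℝ, ∀ᶠ n in (σ.ω : Filter ℕ), dist (y n) (b n) / σ.d n ≤ C}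

theorem PreCone.tendsto {X : Type*} [MetricSpace X] {σ : ConeScale} {b : ℕ → X}
    (x y : PreCone X σ b) :
    Tendsto (fun n => dist (x.1 n) (y.1 n) / σ.d n) σ.ω
      (𝓝 (limUnder (σ.ω : Filter ℕ) fun n => dist (x.1 n) (y.1 n) / σ.d n)) := by
  obtain ⟨C, hC⟩ := x.2
  obtain ⟨D, hD⟩ := y.2
  apply tendsto_nhds_limUnder
  have hmem : ∀ᶠ n in (σ.ω : Filter ℕ),
      dist (x.1 n) (y.1 n) / σ.d n ∈ Set.Icc (0 : ℝ) (C + D) := by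
    filter_upwards [hC, hD] with n h1 h2
    have hd := σ.d_pos n
    refine ⟨by positivity, ?_⟩
    calc dist (x.1 n) (y.1 n) / σ.d n
        ≤ (dist (x.1 n) (b n) + dist (y.1 n) (b n)) / σ.d n := by
          gcongr
          exact dist_triangle_right _ _ _
      _ = dist (x.1 n) (b n) / σ.d n + dist (y.1 n) (b n) / σ.d n := add_div _ _ _
      _ ≤ C + D := add_le_add h1 h2
  obtain ⟨a, -, ha⟩ := (isCompact_Icc (a := (0 : ℝ)) (b := C + D)).ultrafilter_le_nhds
    (σ.ω.map fun n => dist (x.1 n) (y.1 n) / σ.d n) (by rw [Filter.le_principal_iff]; exact hmem)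
  exact ⟨a, ha⟩

/-- The pseudo-distance `dist_ω (x, y) = lim_ω dist (x n, y n) / d n`. -/
noncomputable instance {X : Type*} [MetricSpace X] {σ : ConeScale} {b : ℕ → X} :
    PseudoMetricSpace (PreCone X σ b) where
  dist x y := limUnder (σ.ω : Filter ℕ) fun n => dist (x.1 n) (y.1 n) / σ.d n
  dist_self x := by
    have h := PreCone.tendsto x x
    simp only [dist_self, zero_div] at h
    simpa using tendsto_nhds_unique h tendsto_const_nhds
  dist_comm x y := by simp only [dist_comm]
  dist_triangle x y z := by
    refine le_of_tendsto_of_tendsto (PreCone.tendsto x z)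
      ((PreCone.tendsto x y).add (PreCone.tendsto y z)) (Eventually.of_forall fun n => ?_)
    have hd := σ.d_pos n
    change dist (x.1 n) (z.1 n) / σ.d n ≤
      dist (x.1 n) (y.1 n) / σ.d n + dist (y.1 n) (z.1 n) / σ.d n
    rw [← add_div]
    gcongr
    exact dist_triangle _ _ _

/-- The asymptotic cone `Cone_ω (X, b, d)`: sequences at finite `ω`-distance from `b`, modulo
`ω`-distance zero, with the induced metric. -/
abbrev AsymptoticCone (X : Type*) [MetricSpace X] (σ : ConeScale) (b : ℕ → X) : Type _ :=
  SeparationQuotient (PreCone X σ b)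

/-! ### Unconstricted groups -/

/-- `p` is a (global) cut-point of `X`: the complement of `p` is not connected. Since
`IsConnected` includes non-emptiness, the point of a singleton is a cut-point. -/
def IsCutPoint {X : Type*} [TopologicalSpace X] (p : X) : Prop :=
  ¬ IsConnected ({p}ᶜ : Set X)

/-- The group with the word metric of `S` is unconstricted: (1) for some ultrafilter and some
scaling constants, no asymptotic cone, for any choice of observation points, has a cut-point;
(2) every element is at uniformly bounded distance from a bi-infinite geodesic. As the points of
the word metric are the vertices of the Cayley graph, a bi-infinite geodesic is an isometric
embedding of `ℤ` (the sequence of vertices of a bi-infinite geodesic of the Cayley graph). -/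
def FinGenSet.IsUnconstricted {G : Type*} [Group G] (S : FinGenSet G) : Prop :=
  (∃ σ : ConeScale, ∀ b : ℕ → WordSpace S, ∀ p : AsymptoticCone (WordSpace S) σ b,
    ¬ IsCutPoint p) ∧
  (∃ c : ℝ, ∀ x : WordSpace S, ∃ γ : ℤ → WordSpace S, Isometry γ ∧ ∃ k : ℤ, dist x (γ k) ≤ c)

/-- A finitely generated group is unconstricted if it is so for its word metrics. -/
def IsUnconstrictedGroup (G : Type*) [Group G] : Prop :=
  Group.FG G ∧ ∀ S : FinGenSet G, S.IsUnconstricted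

/-! ### Algebraic networks and algebraic thickness -/

/-- `H` is undistorted in `G`: word metrics of `H` are bi-Lipschitz equivalent to restrictions
to `H` of word metrics of `G`. -/
def IsUndistorted {G : Type*} [Group G] (H : Subgroup G) : Prop :=
  ∀ (S : FinGenSet G) (T : FinGenSet H), ∃ L : ℝ, ∀ h h' : H,
    dist (α := WordSpace T) h h' ≤ L * dist (α := WordSpace S) (h : G) (h' : G) ∧
    dist (α := WordSpace S) (h : G) (h' : G) ≤ L * dist (α := WordSpace T) h h'

/-- `G`, with the word metric of `S`, is an `M`-algebraic network with respect to the finite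
non-empty collection `ℋ` of subgroups. -/
structure IsAlgebraicNetwork {G : Type*} [Group G] (S : FinGenSet G) (M : ℝ)
    (ℋ : Set (Subgroup G)) : Prop where
  finite : ℋ.Finite
  nonempty : ℋ.Nonempty
  fg : ∀ H ∈ ℋ, H.FG
  undistorted : ∀ H ∈ ℋ, IsUndistorted H
  exists_finiteIndex : ∃ G₁ : Subgroup G, G₁.FiniteIndex ∧
    (∀ g : G, ∃ h ∈ G₁, dist (α := WordSpace S) g h < M) ∧
    ∃ T : Set G, T.Finite ∧ Subgroup.closure T = G₁ ∧ T ⊆ ⋃ H ∈ ℋ, (H : Set G)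
  thickly_connected : ∀ H ∈ ℋ, ∀ H' ∈ ℋ, Relation.ReflTransGen
    (fun K K' => K ∈ ℋ ∧ K' ∈ ℋ ∧ ((K : Set G) ∩ (K' : Set G)).Infinite) H H'

/-- The group `G` is algebraically thick of order at most `n`. For `n = 0`: `G` is unconstricted.
For `n + 1`: `G` is finitely generated and there is a collection `ℋ` of subgroups, each
algebraically thick of order at most `n`, such that for every word metric on `G` there is `M > 0`
for which `G` is an `M`-algebraic network with respect to `ℋ`. -/
def IsAlgThickOfOrderAtMost : ℕ → (G : Type*) → [Group G] → Prop
  | 0, G, _ => IsUnconstrictedGroup G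
  | n + 1, G, _ => Group.FG G ∧ ∃ ℋ : Set (Subgroup G),
      (∀ S : FinGenSet G, ∃ M : ℝ, 0 < M ∧ IsAlgebraicNetwork S M ℋ) ∧
      ∀ H ∈ ℋ, IsAlgThickOfOrderAtMost n H

/-! ### Artin groups -/

/-- The alternating product `(a, b)_m = a b a ⋯` with `m` factors. -/
def altProd {G : Type*} [Monoid G] : ℕ → G → G → G
  | 0, _, _ => 1
  | m + 1, a, b => a * altProd m b a

/-- The Artin group with labels `m i j`, `i ≠ j`. In Mathlib's `CoxeterMatrix` the label `∞` is
encoded by `0`; then both alternating products are `1` and the relator is trivial. -/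
abbrev ArtinGroup {ι : Type*} (m : CoxeterMatrix ι) : Type _ :=
  PresentedGroup {r : FreeGroup ι | ∃ i j : ι, i ≠ j ∧
    r = altProd (m i j) (FreeGroup.of i) (FreeGroup.of j) *
      (altProd (m j i) (FreeGroup.of j) (FreeGroup.of i))⁻¹}

/-- The Artin presentation graph: `i` and `j` are joined iff `m i j < ∞`. -/
def artinGraph {ι : Type*} (m : CoxeterMatrix ι) : SimpleGraph ι where
  Adj i j := i ≠ j ∧ m i j ≠ 0
  symm := ⟨fun i j h => ⟨h.1.symm, by rw [m.symmetric]; exact h.2⟩⟩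
  loopless := ⟨fun _ h => h.1 rfl⟩

/-- All labels are even integers or `∞` (encoded by the even number `0`). -/
def IsEvenArtin {ι : Type*} (m : CoxeterMatrix ι) : Prop :=
  ∀ i j : ι, i ≠ j → m i j = 0 ∨ Even (m i j)

/-! ### Word lengths and homomorphisms -/

/-! The network consists of the subgroups `⟨x_i, x_j⟩` over the edges of the presentation graph.
Evenness makes each relation `(ab)^k = (ba)^k`, which survives killing generators and mapping to any
abelian group. Hence each generator has an exponent sum `e_i` to `ℤ`, and each edge subgroup is a
retract, so undistorted. Edges with a common vertex give subgroups sharing an `x_i`, of infinite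
order by `e_i`; connectedness of the graph does the rest.

Edge subgroups are unconstricted by `isUnconstrictedGroup_of_central`, applied to the central
element `z = (x_i x_j)^k`, to `φ = e_i` with `φ z = k ≠ 0`, and to `ψ = e_i - e_j`, which kills `z`
but not `x_i`. Homomorphisms to `ℤ` are Lipschitz, so a path in a cone avoids `p` as long as `φ` or
`ψ` differs from its value at `p` by a definite multiple of the scale. Any point other than `p` can
be moved until its `ψ`-value is far from that of `p`. Two such points are joined by a detour
(`PreCone.IsFar.joinedIn`): up along powers of `z`, which leaves `ψ` fixed, across along a geodesic
translated so high that `φ` is far from its value at `p`, and down again. Bi-infinite geodesics are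
translates of the powers of a letter maximizing `|φ|`. -/

theorem FinGenSet.length_le_one {G : Type*} [Group G] (S : FinGenSet G) {s : G}
    (hs : s ∈ S.gens ∨ s⁻¹ ∈ S.gens) : S.length s ≤ 1 := by
  simpa using S.length_le [s] (by simpa using hs)

theorem FinGenSet.length_pow_le {G : Type*} [Group G] (S : FinGenSet G) (g : G) (n : ℕ) :
    S.length (g ^ n) ≤ n * S.length g := by
  induction n with
  | zero => simp [S.length_one]
  | succ n ih =>
    rw [pow_succ, add_mul, one_mul]
    exact (S.length_mul_le _ _).trans (by gcongr)

theorem FinGenSet.length_zpow_le {G : Type*} [Group G] (S : FinGenSet G) (g : G) (k : ℤ) :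
    (S.length (g ^ k) : ℝ) ≤ |(k : ℝ)| * S.length g := by
  have key : S.length (g ^ k) ≤ k.natAbs * S.length g := by
    rcases Int.natAbs_eq k with h | h
    · rw [h, zpow_natCast, Int.natAbs_natCast]
      exact S.length_pow_le g _
    · rw [h, zpow_neg, zpow_natCast, S.length_inv, Int.natAbs_neg, Int.natAbs_natCast]
      exact S.length_pow_le g _
  have h2 : ((k.natAbs : ℕ) : ℝ) = |(k : ℝ)| := by rw [Nat.cast_natAbs, Int.cast_abs]
  rw [← h2]
  exact_mod_cast key

/-- A subadditive function is bounded on words by its bound on letters. -/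
theorem FinGenSet.le_mul_length {G : Type*} [Group G] (S : FinGenSet G) (F : G → ℕ)
    (h1 : F 1 = 0) (hmul : ∀ g h, F (g * h) ≤ F g + F h) {K : ℕ}
    (hK : ∀ s, s ∈ S.gens ∨ s⁻¹ ∈ S.gens → F s ≤ K) (g : G) : F g ≤ K * S.length g := by
  obtain ⟨l, hl, rfl, hll⟩ := S.exists_word g
  rw [← hll]
  clear hll
  induction l with
  | nil => simp [h1]
  | cons s l ih =>
    simp only [List.prod_cons, List.length_cons]
    have := hmul s l.prod
    have h2 := hK s (hl s (by simp))
    have h3 := ih fun t ht => hl t (by simp [ht])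
    rw [mul_add, mul_one]
    omega

theorem FinGenSet.exists_bound_letters {G : Type*} [Group G] (S : FinGenSet G) (F : G → ℕ)
    (hinv : ∀ g, F g⁻¹ = F g) : ∃ K, ∀ s, s ∈ S.gens ∨ s⁻¹ ∈ S.gens → F s ≤ K := by
  refine ⟨S.gens.sup F, fun s hs => ?_⟩
  rcases hs with hs | hs
  · exact Finset.le_sup (f := F) hs
  · rw [← hinv]
    exact Finset.le_sup (f := F) hs

theorem exists_length_map_le {G H : Type*} [Group G] [Group H] (f : G →* H) (S : FinGenSet G)
    (T : FinGenSet H) : ∃ K : ℕ, ∀ g, T.length (f g) ≤ K * S.length g := by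
  obtain ⟨K, hK⟩ := S.exists_bound_letters (fun g => T.length (f g))
    (fun g => by rw [map_inv, T.length_inv])
  exact ⟨K, S.le_mul_length _ (by simp [T.length_one])
    (fun g h => by rw [map_mul]; exact T.length_mul_le _ _) hK⟩

theorem exists_abs_toAdd_le {G : Type*} [Group G] (f : G →* Multiplicative ℤ)
    (S : FinGenSet G) : ∃ K : ℝ, 0 ≤ K ∧ ∀ g, |((f g).toAdd : ℝ)| ≤ K * S.length g := by
  obtain ⟨K, hK⟩ := S.exists_bound_letters (fun g => (f g).toAdd.natAbs) (fun g => by simp)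
  refine ⟨K, K.cast_nonneg, fun g => ?_⟩
  have := S.le_mul_length (fun g => (f g).toAdd.natAbs) (by simp)
    (fun g h => by rw [map_mul, toAdd_mul]; exact Int.natAbs_add_le _ _) hK g
  rw [← Int.cast_abs, ← Nat.cast_natAbs]
  exact_mod_cast this

/-- A group with a nontrivial homomorphism to `ℤ` contains a bi-infinite geodesic: the powers of
a letter on which the homomorphism is largest. -/
theorem FinGenSet.exists_geodesic_zpow {G : Type*} [Group G] (S : FinGenSet G)
    (f : G →* Multiplicative ℤ) {a : G} (ha : f a ≠ 1) :
    ∃ s : G, ∀ k : ℤ, S.length (s ^ k) = k.natAbs := by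
  have hne : S.gens.Nonempty := by
    by_contra h
    have h1 := S.closure_eq_top
    rw [Finset.not_nonempty_iff_eq_empty.1 h] at h1
    have h2 : a ∈ Subgroup.closure ((∅ : Finset G) : Set G) := h1 ▸ Subgroup.mem_top a
    have h3 : a = 1 := by simpa using h2
    exact ha (by rw [h3, map_one])
  obtain ⟨s, hs, hmax⟩ := S.gens.exists_max_image (fun g => (f g).toAdd.natAbs) hne
  have key := S.le_mul_length (fun g => (f g).toAdd.natAbs) (by simp)
    (fun g h => by rw [map_mul, toAdd_mul]; exact Int.natAbs_add_le _ _)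
    (K := (f s).toAdd.natAbs) (fun t ht => by
      rcases ht with ht | ht
      · exact hmax t ht
      · simpa using hmax _ ht)
  have hpos : 0 < (f s).toAdd.natAbs := by
    rcases Nat.eq_zero_or_pos (f s).toAdd.natAbs with h | h
    · have := key a
      simp only [h, zero_mul, nonpos_iff_eq_zero, Int.natAbs_eq_zero] at this
      exact absurd (toAdd_eq_zero.1 this) ha
    · exact h
  refine ⟨s, fun k => le_antisymm ?_ ?_⟩
  · have h1 := S.length_zpow_le s k
    have h2 : (S.length s : ℝ) ≤ 1 := by exact_mod_cast S.length_le_one (Or.inl hs)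
    have h3 : (S.length (s ^ k) : ℝ) ≤ (k.natAbs : ℕ) := by
      rw [Nat.cast_natAbs, Int.cast_abs]
      exact h1.trans (mul_le_of_le_one_right (abs_nonneg _) h2)
    exact_mod_cast h3
  -- `|k| |f s| = |f (s ^ k)| ≤ |f s| · length (s ^ k)`, and `|f s|` cancels.
  · have h1 := key (s ^ k)
    simp only [map_zpow, toAdd_zpow, smul_eq_mul, Int.natAbs_mul] at h1
    rw [mul_comm] at h1
    exact Nat.le_of_mul_le_mul_left h1 hpos

theorem WordSpace.dist_eq {G : Type*} [Group G] (S : FinGenSet G) (g h : G) :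
    dist (α := WordSpace S) g h = (S.length (g⁻¹ * h) : ℝ) := rfl

theorem FinGenSet.exists_isometry_through {G : Type*} [Group G] (S : FinGenSet G)
    (f : G →* Multiplicative ℤ) {a : G} (ha : f a ≠ 1) (x : WordSpace S) :
    ∃ γ : ℤ → WordSpace S, Isometry γ ∧ γ 0 = x := by
  obtain ⟨s, hs⟩ := S.exists_geodesic_zpow f ha
  let x' : G := x
  refine ⟨fun k => (x' * s ^ k : G), Isometry.of_dist_eq fun k l => ?_, ?_⟩
  · rw [WordSpace.dist_eq, show (x' * s ^ k)⁻¹ * (x' * s ^ l) = s ^ (l - k) by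
      rw [sub_eq_neg_add, zpow_add, zpow_neg]; group, hs, dist_comm, Int.dist_eq,
      Nat.cast_natAbs, Int.cast_abs, Int.cast_sub]
  · change x' * s ^ (0 : ℤ) = x'
    simp

/-! ### Paths in asymptotic cones -/

theorem ConeScale.eventually_ge (σ : ConeScale) (c : ℝ) :
    ∀ᶠ n in (σ.ω : Filter ℕ), c ≤ σ.d n :=
  σ.tendsto_d.eventually_ge_atTop c

theorem PreCone.dist_le {X : Type*} [MetricSpace X] {σ : ConeScale} {b : ℕ → X}
    (x y : PreCone X σ b) {C : ℝ}
    (h : ∀ᶠ n in (σ.ω : Filter ℕ), dist (x.1 n) (y.1 n) / σ.d n ≤ C) : dist x y ≤ C :=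
  le_of_tendsto (PreCone.tendsto x y) h

theorem PreCone.le_dist {X : Type*} [MetricSpace X] {σ : ConeScale} {b : ℕ → X}
    (x y : PreCone X σ b) {C : ℝ}
    (h : ∀ᶠ n in (σ.ω : Filter ℕ), C ≤ dist (x.1 n) (y.1 n) / σ.d n) : C ≤ dist x y :=
  ge_of_tendsto (PreCone.tendsto x y) h

theorem PreCone.exists_bound {X : Type*} [MetricSpace X] {σ : ConeScale} {b : ℕ → X}
    (x y : PreCone X σ b) :
    ∃ C : ℝ, 0 ≤ C ∧ ∀ᶠ n in (σ.ω : Filter ℕ), dist (x.1 n) (y.1 n) ≤ C * σ.d n := by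
  refine ⟨dist x y + 1, by positivity, ?_⟩
  filter_upwards [(PreCone.tendsto x y).eventually_le_const (lt_add_one (dist x y))] with n hn
  exact (div_le_iff₀ (σ.d_pos n)).1 hn

/-- Coarsely Lipschitz maps with constants proportional to the scale have a Lipschitz limit. -/
theorem PreCone.exists_continuous {X : Type*} [MetricSpace X] {σ : ConeScale} {b : ℕ → X}
    (x : PreCone X σ b) (f : ℕ → ℝ → X) (h0 : ∀ n, f n 0 = x.1 n) (K C : ℝ)
    (hf : ∀ᶠ n in (σ.ω : Filter ℕ), ∀ s t,
      dist (f n s) (f n t) ≤ K * σ.d n * |s - t| + C) :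
    ∃ F : ℝ → PreCone X σ b, (∀ t n, (F t).1 n = f n t) ∧ Continuous F := by
  -- The additive error `C` vanishes in the limit because `d n → ∞`.
  have hf' : ∀ ε > 0, ∀ᶠ n in (σ.ω : Filter ℕ), ∀ s t,
      dist (f n s) (f n t) / σ.d n ≤ K * |s - t| + ε := by
    intro ε hε
    filter_upwards [hf, σ.eventually_ge (C / ε)] with n hn hd s t
    rw [div_le_iff₀ (σ.d_pos n)]
    have := (div_le_iff₀ hε).1 hd
    linarith [hn s t]
  obtain ⟨B, hB⟩ := x.2
  have hmem : ∀ t, ∃ C : ℝ, ∀ᶠ n in (σ.ω : Filter ℕ), dist (f n t) (b n) / σ.d n ≤ C := by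
    intro t
    refine ⟨K * |t - 0| + 1 + B, ?_⟩
    filter_upwards [hB, hf' 1 one_pos] with n h1 h2
    have hd := σ.d_pos n
    calc dist (f n t) (b n) / σ.d n
        ≤ (dist (f n t) (f n 0) + dist (f n 0) (b n)) / σ.d n := by
          gcongr
          exact dist_triangle _ _ _
      _ = dist (f n t) (f n 0) / σ.d n + dist (x.1 n) (b n) / σ.d n := by rw [add_div, h0]
      _ ≤ _ := add_le_add (h2 t 0) h1
  refine ⟨fun t => ⟨fun n => f n t, hmem t⟩, fun _ _ => rfl, ?_⟩
  let F : ℝ → PreCone X σ b := fun t => ⟨fun n => f n t, hmem t⟩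
  have hL : LipschitzWith (Real.toNNReal K) F := by
    refine LipschitzWith.of_dist_le_mul fun s t => ?_
    refine le_trans ?_ (mul_le_mul_of_nonneg_right (Real.le_coe_toNNReal K) dist_nonneg)
    refine le_of_forall_pos_le_add fun ε hε => ?_
    refine PreCone.dist_le _ _ ?_
    filter_upwards [hf' ε hε] with n hn
    exact hn s t
  exact hL.continuous

/-- The representing sequence of a point of the cone of a group, as a sequence of group elements. -/
def PreCone.rep {G : Type*} [Group G] {S : FinGenSet G} {σ : ConeScale} {b : ℕ → WordSpace S}
    (x : PreCone (WordSpace S) σ b) (n : ℕ) : G := x.1 n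

theorem abs_floor_sub_floor_le (u v : ℝ) : |((⌊u⌋ : ℝ) - ⌊v⌋)| ≤ |u - v| + 1 := by
  have h1 := Int.floor_le u
  have h2 := Int.lt_floor_add_one u
  have h3 := Int.floor_le v
  have h4 := Int.lt_floor_add_one v
  rw [abs_le]
  constructor
  · linarith [neg_abs_le (u - v)]
  · linarith [le_abs_self (u - v)]

/-- The path `t ↦ [x_n g ^ ⌊t T d_n⌋]` in the cone. -/
theorem PreCone.exists_zpow_path {G : Type*} [Group G] {S : FinGenSet G} {σ : ConeScale}
    {b : ℕ → WordSpace S} (x : PreCone (WordSpace S) σ b) (g : G) (T : ℝ) (hT : 0 ≤ T) :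
    ∃ F : ℝ → PreCone (WordSpace S) σ b, Continuous F ∧
      (∀ t n, (F t).rep n = x.rep n * g ^ ⌊t * (T * σ.d n)⌋) ∧ F 0 = x := by
  obtain ⟨F, hF, hc⟩ := x.exists_continuous
    (fun n t => (x.rep n * g ^ ⌊t * (T * σ.d n)⌋ : G))
    (fun n => by
      change x.rep n * _ = x.rep n
      simp) (T * S.length g) (S.length g) (by
    filter_upwards with n s t
    have hd := σ.d_pos n
    rw [WordSpace.dist_eq, show (x.rep n * g ^ ⌊s * (T * σ.d n)⌋)⁻¹ *
      (x.rep n * g ^ ⌊t * (T * σ.d n)⌋) = g ^ (⌊t * (T * σ.d n)⌋ - ⌊s * (T * σ.d n)⌋) by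
        rw [sub_eq_neg_add, zpow_add, zpow_neg]; group]
    refine (S.length_zpow_le _ _).trans ?_
    have h1 := abs_floor_sub_floor_le (t * (T * σ.d n)) (s * (T * σ.d n))
    rw [← sub_mul, abs_mul, abs_of_nonneg (mul_nonneg hT hd.le), abs_sub_comm t s] at h1
    rw [Int.cast_sub]
    calc _ ≤ (|s - t| * (T * σ.d n) + 1) * S.length g := by gcongr
      _ = _ := by ring)
  refine ⟨F, hc, hF, Subtype.ext (funext fun n => ?_)⟩
  rw [hF]
  change x.rep n * _ = x.rep n
  simp

/-- Points of a cone are joined by limits of geodesics, which may be translated on the right by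
powers of a central element. -/
theorem PreCone.exists_geodesic_path {G : Type*} [Group G] {S : FinGenSet G} {σ : ConeScale}
    {b : ℕ → WordSpace S} (x y x' y' : PreCone (WordSpace S) σ b) {z : G}
    (hz : ∀ g, z * g = g * z) (k : ℕ → ℤ) (hx : ∀ n, x'.rep n = x.rep n * z ^ k n)
    (hy : ∀ n, y'.rep n = y.rep n * z ^ k n) :
    ∃ F : ℝ → PreCone (WordSpace S) σ b, Continuous F ∧ F 0 = x' ∧ F 1 = y' ∧
      ∀ t n, ∃ u : G, (F t).rep n = x.rep n * u * z ^ k n ∧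
        (S.length u : ℝ) ≤ dist (x.1 n) (y.1 n) := by
  -- Prefixes of a shortest word trace a geodesic from `x_n` to `y_n`; time `t` takes the first `⌊t
  -- |w n|⌋₊` letters.
  choose w hw hprod hlen using fun n => S.exists_word ((x.rep n)⁻¹ * y.rep n)
  have hdist : ∀ n, dist (x.1 n) (y.1 n) = ((w n).length : ℝ) := fun n => by
    rw [hlen]; rfl
  obtain ⟨C, hC0, hC⟩ := x.exists_bound y
  obtain ⟨F, hF, hc⟩ := x'.exists_continuous
    (fun n t => (x.rep n * ((w n).take ⌊t * (w n).length⌋₊).prod * z ^ k n : G))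
    (fun n => by
      refine Eq.trans ?_ (hx n).symm
      change x.rep n * _ * _ = x.rep n * _
      simp) C 1 (by
    filter_upwards [hC] with n hn s t
    rw [hdist] at hn
    wlog hst : s ≤ t generalizing s t
    · rw [abs_sub_comm]
      exact (dist_comm (α := WordSpace S) _ _).trans_le (this t s (le_of_not_ge hst))
    have hij : ⌊s * (w n).length⌋₊ ≤ ⌊t * (w n).length⌋₊ :=
      Nat.floor_le_floor (mul_le_mul_of_nonneg_right hst (Nat.cast_nonneg _))
    have hsplit : ((w n).take ⌊t * (w n).length⌋₊).prod =
        ((w n).take ⌊s * (w n).length⌋₊).prod *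
        (((w n).take ⌊t * (w n).length⌋₊).drop ⌊s * (w n).length⌋₊).prod := by
      rw [← List.prod_take_mul_prod_drop _ ⌊s * (w n).length⌋₊, List.take_take,
        min_eq_left hij]
    -- Centrality cancels the translation, leaving the subword `v` between two prefixes.
    have hcomm : ∀ g, z ^ k n * g = g * z ^ k n := fun g =>
      ((show Commute z g from hz g).zpow_left (k n)).eq
    rw [WordSpace.dist_eq, hsplit]
    set v := (((w n).take ⌊t * (w n).length⌋₊).drop ⌊s * (w n).length⌋₊).prod
    set u := ((w n).take ⌊s * (w n).length⌋₊).prod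
    rw [show (x.rep n * u * z ^ k n)⁻¹ * (x.rep n * (u * v) * z ^ k n) = v by
      rw [← mul_assoc (x.rep n) u v, mul_assoc (x.rep n * u) v, ← hcomm v]; group]
    have h1 : S.length v ≤ ⌊t * (w n).length⌋₊ - ⌊s * (w n).length⌋₊ := by
      refine (S.length_le _ fun a ha =>
        hw n a (List.mem_of_mem_take (List.mem_of_mem_drop ha))).trans ?_
      simp only [List.length_drop, List.length_take]
      omega
    have h2 : (S.length v : ℝ) ≤ (⌊t * (w n).length⌋₊ : ℝ) - ⌊s * (w n).length⌋₊ := by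
      rw [← Nat.cast_sub hij]
      exact_mod_cast h1
    have hd := σ.d_pos n
    have hfl := Nat.lt_floor_add_one (s * (w n).length)
    rw [abs_sub_comm, abs_of_nonneg (sub_nonneg.2 hst)]
    have h4 : (t - s) * (w n).length ≤ (t - s) * (C * σ.d n) :=
      mul_le_mul_of_nonneg_left hn (sub_nonneg.2 hst)
    -- The path is defined on all of `ℝ`; at negative times `⌊·⌋₊` is `0` and the prefix is empty.
    rcases le_or_gt 0 t with ht | ht
    · have h3 := Nat.floor_le (mul_nonneg ht (Nat.cast_nonneg (w n).length))
      linarith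
    · have h3 : ⌊t * (w n).length⌋₊ = 0 :=
        Nat.floor_of_nonpos (mul_nonpos_of_nonpos_of_nonneg ht.le (Nat.cast_nonneg _))
      rw [h3, Nat.cast_zero] at h2
      have h5 : (0 : ℝ) ≤ (t - s) * (C * σ.d n) :=
        mul_nonneg (sub_nonneg.2 hst) (mul_nonneg hC0 hd.le)
      have h6 : (0 : ℝ) ≤ ⌊s * (w n).length⌋₊ := Nat.cast_nonneg _
      linarith)
  refine ⟨F, hc, Subtype.ext (funext fun n => ?_), Subtype.ext (funext fun n => ?_),
    fun t n => ⟨_, hF t n, ?_⟩⟩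
  · refine (hF 0 n).trans (Eq.trans ?_ (hx n).symm)
    change x.rep n * _ * _ = x.rep n * _
    simp
  · refine (hF 1 n).trans (Eq.trans ?_ (hy n).symm)
    change x.rep n * _ * _ = y.rep n * _
    rw [one_mul, Nat.floor_natCast, List.take_length, hprod, mul_inv_cancel_left]
  · rw [hdist]
    have := S.length_le ((w n).take ⌊t * (w n).length⌋₊)
      (fun a ha => hw n a (List.mem_of_mem_take ha))
    have h2 := List.length_take_le' ⌊t * (w n).length⌋₊ (w n)
    exact_mod_cast this.trans h2

/-- The homomorphism `f` separates `x` from `p` at the scale of the cone. -/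
def PreCone.IsFar {G : Type*} [Group G] {S : FinGenSet G} {σ : ConeScale} {b : ℕ → WordSpace S}
    (f : G →* Multiplicative ℤ) (p x : PreCone (WordSpace S) σ b) : Prop :=
  ∃ ε : ℝ, 0 < ε ∧ ∀ᶠ n in (σ.ω : Filter ℕ),
    ε * σ.d n ≤ |((f ((p.rep n)⁻¹ * x.rep n)).toAdd : ℝ)|

theorem PreCone.IsFar.dist_pos {G : Type*} [Group G] {S : FinGenSet G} {σ : ConeScale}
    {b : ℕ → WordSpace S} {f : G →* Multiplicative ℤ} {p x : PreCone (WordSpace S) σ b}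
    (h : PreCone.IsFar f p x) : 0 < dist p x := by
  obtain ⟨ε, hε, h⟩ := h
  obtain ⟨K, hK0, hK⟩ := exists_abs_toAdd_le f S
  refine lt_of_lt_of_le (show 0 < ε / (K + 1) by positivity) (PreCone.le_dist _ _ ?_)
  filter_upwards [h] with n hn
  have h1 := hK ((p.rep n)⁻¹ * x.rep n)
  rw [← WordSpace.dist_eq] at h1
  change _ ≤ K * dist (p.1 n) (x.1 n) at h1
  have h2 : (0 : ℝ) ≤ dist (p.1 n) (x.1 n) := dist_nonneg
  rw [div_le_div_iff₀ (by positivity) (σ.d_pos n)]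
  linarith

/-- Every point other than `p` can be joined to a far point while avoiding `p`. -/
theorem PreCone.exists_joinedIn_isFar {G : Type*} [Group G] {S : FinGenSet G} {σ : ConeScale}
    {b : ℕ → WordSpace S} {f : G →* Multiplicative ℤ} {a : G} (ha : f a ≠ 1)
    (p x : PreCone (WordSpace S) σ b) (hx : 0 < dist p x) :
    ∃ y, PreCone.IsFar f p y ∧ JoinedIn {q | 0 < dist p q} x y := by
  by_cases hfar : PreCone.IsFar f p x
  · exact ⟨x, hfar, JoinedIn.refl hx⟩
  obtain ⟨F, hc, hF, hF0⟩ := x.exists_zpow_path a 1 zero_le_one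
  have hpos : ∀ t, 0 < t → PreCone.IsFar f p (F t) := by
    intro t ht
    refine ⟨t / 2, by positivity, ?_⟩
    -- For an ultrafilter, failing to be far means being `ω`-almost surely close, for every `t`.
    have hx0 : ∀ᶠ n in (σ.ω : Filter ℕ),
        |((f ((p.rep n)⁻¹ * x.rep n)).toAdd : ℝ)| < t / 4 * σ.d n := by
      by_contra hcon
      refine hfar ⟨t / 4, by positivity, ?_⟩
      rw [← Ultrafilter.eventually_not] at hcon
      filter_upwards [hcon] with n hn
      exact not_lt.1 hn
    -- Of the displacement `t d_n`, the floor costs `1 ≤ t d_n / 4` and the initial offset at most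
    -- `t d_n / 4`, so `t d_n / 2` remains.
    filter_upwards [hx0, σ.eventually_ge (4 / t)] with n h1 h2
    have h3 := (div_le_iff₀ ht).1 h2
    rw [hF]
    rw [← mul_assoc, map_mul, map_zpow, toAdd_mul, toAdd_zpow, smul_eq_mul, Int.cast_add,
      Int.cast_mul]
    have hfa : (1 : ℝ) ≤ |((f a).toAdd : ℝ)| := by
      rw [← Int.cast_abs]
      exact_mod_cast Int.one_le_abs (fun h => ha (toAdd_eq_zero.1 h))
    have h4 := Int.lt_floor_add_one (t * (1 * σ.d n))
    rw [one_mul] at h4 ⊢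
    have h5 : (⌊t * σ.d n⌋ : ℝ) ≤ |(⌊t * σ.d n⌋ : ℝ) * ((f a).toAdd : ℝ)| := by
      rw [abs_mul]
      exact (le_abs_self _).trans (le_mul_of_one_le_right (abs_nonneg _) hfa)
    have h6 := abs_sub_abs_le_abs_sub ((⌊t * σ.d n⌋ : ℝ) * ((f a).toAdd : ℝ))
      (-((f ((p.rep n)⁻¹ * x.rep n)).toAdd : ℝ))
    rw [abs_neg, sub_neg_eq_add, add_comm ((⌊t * σ.d n⌋ : ℝ) * _)] at h6
    linarith
  refine ⟨F 1, hpos 1 one_pos, JoinedIn.ofLine hc.continuousOn hF0 rfl ?_⟩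
  -- At `t = 0` the point is not far; there the hypothesis `0 < dist p x` is used.
  rintro _ ⟨t, ht, rfl⟩
  rcases ht.1.eq_or_lt with h | h
  · rw [← h, hF0]
    exact hx
  · exact (hpos t h).dist_pos

/-- Translating by powers of a central element joins a far point to a point of the same
`ψ`-coordinate. -/
theorem PreCone.IsFar.joinedIn_zpow {G : Type*} [Group G] {S : FinGenSet G} {σ : ConeScale}
    {b : ℕ → WordSpace S} {ψ : G →* Multiplicative ℤ} {z : G} (hz : ψ z = 1)
    {p x : PreCone (WordSpace S) σ b} (hx : PreCone.IsFar ψ p x) (T : ℝ) (hT : 0 ≤ T) :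
    ∃ x' : PreCone (WordSpace S) σ b, JoinedIn {q | 0 < dist p q} x x' ∧
      ∀ n, x'.rep n = x.rep n * z ^ ⌊T * σ.d n⌋ := by
  obtain ⟨F, hc, hF, hF0⟩ := x.exists_zpow_path z T hT
  refine ⟨F 1, JoinedIn.ofLine hc.continuousOn hF0 rfl ?_, fun n => by rw [hF, one_mul]⟩
  rintro _ ⟨t, -, rfl⟩
  refine PreCone.IsFar.dist_pos (f := ψ) ?_
  obtain ⟨ε, hε, h⟩ := hx
  refine ⟨ε, hε, ?_⟩
  filter_upwards [h] with n hn
  rw [hF]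
  rwa [← mul_assoc, map_mul, map_zpow, hz, one_zpow, mul_one]

/-- The detour: `ψ` keeps the two vertical legs along `z` away from `p`, and `φ` does so for the
translated geodesic. -/
theorem PreCone.IsFar.joinedIn {G : Type*} [Group G] {S : FinGenSet G} {σ : ConeScale}
    {b : ℕ → WordSpace S} {φ ψ : G →* Multiplicative ℤ} {z : G} (hcen : ∀ g, z * g = g * z)
    (hφ : φ z ≠ 1) (hψ : ψ z = 1) {p x y : PreCone (WordSpace S) σ b}
    (hx : PreCone.IsFar ψ p x) (hy : PreCone.IsFar ψ p y) :
    JoinedIn {q | 0 < dist p q} x y := by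
  obtain ⟨K, hK0, hK⟩ := exists_abs_toAdd_le φ S
  obtain ⟨C, hC0, hC⟩ := p.exists_bound x
  obtain ⟨D, hD0, hD⟩ := x.exists_bound y
  -- On the geodesic before translation, `φ` differs from its value at `p` by at most `K (C + D)
  -- d_n`. The extra `2` absorbs the floor and leaves `2 d_n - 1 ≥ d_n`.
  set T : ℝ := K * (C + D) + 2 with hTdef
  have hT : 0 ≤ T := by positivity
  obtain ⟨x', hxx', hx'⟩ := hx.joinedIn_zpow hψ T hT
  obtain ⟨y', hyy', hy'⟩ := hy.joinedIn_zpow hψ T hT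
  obtain ⟨F, hc, hF0, hF1, hF⟩ := x.exists_geodesic_path y x' y' hcen _ hx' hy'
  refine (hxx'.trans (JoinedIn.ofLine hc.continuousOn hF0 hF1 ?_)).trans hyy'.symm
  rintro _ ⟨t, -, rfl⟩
  refine PreCone.IsFar.dist_pos (f := φ) ⟨1, one_pos, ?_⟩
  filter_upwards [hC, hD, σ.eventually_ge 1] with n h1 h2 h3
  obtain ⟨u, hu, hul⟩ := hF t n
  rw [hu]
  rw [show (p.rep n)⁻¹ * (x.rep n * u * z ^ ⌊T * σ.d n⌋) =
    (p.rep n)⁻¹ * x.rep n * u * z ^ ⌊T * σ.d n⌋ by group, map_mul, map_zpow, toAdd_mul,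
    toAdd_zpow, smul_eq_mul, Int.cast_add, Int.cast_mul]
  have h4 := hK ((p.rep n)⁻¹ * x.rep n * u)
  have h5 : (S.length ((p.rep n)⁻¹ * x.rep n * u) : ℝ) ≤ (C + D) * σ.d n := by
    have h6 : (S.length ((p.rep n)⁻¹ * x.rep n * u) : ℝ) ≤
        dist (p.1 n) (x.1 n) + S.length u := by
      change _ ≤ (S.length ((p.rep n)⁻¹ * x.rep n) : ℝ) + _
      exact_mod_cast S.length_mul_le _ _
    linarith
  have h6 := mul_le_mul_of_nonneg_left h5 hK0
  have hfa : (1 : ℝ) ≤ |((φ z).toAdd : ℝ)| := by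
    rw [← Int.cast_abs]
    exact_mod_cast Int.one_le_abs (fun h => hφ (toAdd_eq_zero.1 h))
  have h7 : (⌊T * σ.d n⌋ : ℝ) ≤ |(⌊T * σ.d n⌋ : ℝ) * ((φ z).toAdd : ℝ)| := by
    rw [abs_mul]
    exact (le_abs_self _).trans (le_mul_of_one_le_right (abs_nonneg _) hfa)
  have h8 := Int.lt_floor_add_one (T * σ.d n)
  have h9 := abs_sub_abs_le_abs_sub ((⌊T * σ.d n⌋ : ℝ) * ((φ z).toAdd : ℝ))
    (-((φ ((p.rep n)⁻¹ * x.rep n * u)).toAdd : ℝ))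
  rw [abs_neg, sub_neg_eq_add, add_comm ((⌊T * σ.d n⌋ : ℝ) * _)] at h9
  have h10 : T * σ.d n = K * ((C + D) * σ.d n) + 2 * σ.d n := by rw [hTdef]; ring
  linarith

theorem PreCone.isPathConnected_compl {G : Type*} [Group G] {S : FinGenSet G} {σ : ConeScale}
    {b : ℕ → WordSpace S} {φ ψ : G →* Multiplicative ℤ} {z a : G} (hcen : ∀ g, z * g = g * z)
    (hφ : φ z ≠ 1) (hψ : ψ z = 1) (ha : ψ a ≠ 1) (p : PreCone (WordSpace S) σ b) :
    IsPathConnected {q | 0 < dist p q} := by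
  rw [isPathConnected_iff]
  constructor
  -- The point `p z ^ ⌊2 d_n⌋` has `φ`-displacement at least `2 d_n - 1 ≥ d_n`.
  · obtain ⟨F, -, hF, -⟩ := p.exists_zpow_path z 1 zero_le_one
    refine ⟨F 2, PreCone.IsFar.dist_pos (f := φ) ⟨1, one_pos, ?_⟩⟩
    filter_upwards [σ.eventually_ge 1] with n hn
    rw [hF]
    rw [inv_mul_cancel_left, map_zpow, toAdd_zpow, smul_eq_mul, Int.cast_mul, abs_mul]
    have hfa : (1 : ℝ) ≤ |((φ z).toAdd : ℝ)| := by
      rw [← Int.cast_abs]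
      exact_mod_cast Int.one_le_abs (fun h => hφ (toAdd_eq_zero.1 h))
    have h8 := Int.lt_floor_add_one (2 * (1 * σ.d n))
    have := le_mul_of_one_le_right (abs_nonneg (⌊2 * (1 * σ.d n)⌋ : ℝ)) hfa
    have := le_abs_self (⌊2 * (1 * σ.d n)⌋ : ℝ)
    linarith
  · intro x hx y hy
    obtain ⟨x', hx', hxx'⟩ := PreCone.exists_joinedIn_isFar ha p x hx
    obtain ⟨y', hy', hyy'⟩ := PreCone.exists_joinedIn_isFar ha p y hy
    exact (hxx'.trans (hx'.joinedIn hcen hφ hψ hy')).trans hyy'.symm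

/-- The complement of the class of `p` is the continuous image of the points at positive
pseudo-distance from `p`. -/
theorem AsymptoticCone.not_isCutPoint {G : Type*} [Group G] {S : FinGenSet G} {σ : ConeScale}
    {b : ℕ → WordSpace S} {φ ψ : G →* Multiplicative ℤ} {z a : G} (hcen : ∀ g, z * g = g * z)
    (hφ : φ z ≠ 1) (hψ : ψ z = 1) (ha : ψ a ≠ 1) (p : AsymptoticCone (WordSpace S) σ b) :
    ¬ IsCutPoint p := by
  obtain ⟨p, rfl⟩ := SeparationQuotient.surjective_mk p
  have h := ((PreCone.isPathConnected_compl hcen hφ hψ ha p).image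
    SeparationQuotient.continuous_mk).isConnected
  rw [IsCutPoint, not_not]
  convert h using 1
  ext q
  obtain ⟨q, rfl⟩ := SeparationQuotient.surjective_mk q
  have key : ∀ r : PreCone (WordSpace S) σ b,
      SeparationQuotient.mk r = SeparationQuotient.mk p ↔ ¬ 0 < dist p r := fun r => by
    rw [SeparationQuotient.mk_eq_mk, Metric.inseparable_iff, dist_comm, not_lt]
    exact ⟨fun h => h.le, fun h => le_antisymm h dist_nonneg⟩
  constructor
  · intro hq
    refine ⟨q, ?_, rfl⟩
    by_contra hcon
    exact hq ((key q).2 hcon)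
  · rintro ⟨r, hr, hrq⟩ hq
    exact (key r).1 (hrq.trans hq) hr

theorem ConeScale.nonempty : Nonempty ConeScale :=
  ⟨{ ω := hyperfilter ℕ
     nonprincipal := fun s hs hfin => by
      have := compl_mem_hyperfilter_of_finite hfin
      exact (hyperfilter ℕ).compl_notMem_iff.2 hs this
     d := fun n => (n : ℝ) + 1
     d_pos := fun n => by positivity
     tendsto_d := by
      refine Tendsto.mono_left ?_ (Nat.cofinite_eq_atTop ▸ hyperfilter_le_cofinite)
      exact tendsto_atTop_add_const_right _ _ tendsto_natCast_atTop_atTop }⟩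

/-- A finitely generated group with a central element `z` and homomorphisms `φ`, `ψ` to `ℤ` such
that `φ z ≠ 0`, `ψ z = 0` and `ψ ≠ 0` is unconstricted. -/
theorem isUnconstrictedGroup_of_central {G : Type*} [Group G] (hfg : Group.FG G)
    (φ ψ : G →* Multiplicative ℤ) (z a : G) (hcen : ∀ g, z * g = g * z)
    (hφ : φ z ≠ 1) (hψ : ψ z = 1) (ha : ψ a ≠ 1) : IsUnconstrictedGroup G := by
  refine ⟨hfg, fun S => ⟨?_, 0, fun x => ?_⟩⟩
  · obtain ⟨σ⟩ := ConeScale.nonempty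
    exact ⟨σ, fun b p => AsymptoticCone.not_isCutPoint hcen hφ hψ ha p⟩
  · obtain ⟨γ, hγ, h0⟩ := S.exists_isometry_through φ hφ x
    exact ⟨γ, hγ, 0, by rw [h0, dist_self]⟩

/-- A retract of a group is undistorted. -/
theorem isUndistorted_of_retraction {G : Type*} [Group G] (H : Subgroup G) (r : G →* H)
    (hr : ∀ h : H, r h = h) : IsUndistorted H := by
  intro S T
  -- Both the retraction and the inclusion are Lipschitz for word metrics.
  obtain ⟨K, hK⟩ := exists_length_map_le r S T
  obtain ⟨K', hK'⟩ := exists_length_map_le H.subtype T S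
  refine ⟨(max K K' : ℕ), fun h h' => ?_⟩
  simp only [WordSpace.dist_eq]
  have h1 := hK ((h : G)⁻¹ * (h' : G))
  rw [map_mul, map_inv, hr, hr] at h1
  have h2 := hK' (h⁻¹ * h')
  rw [map_mul, map_inv, H.subtype_apply, H.subtype_apply] at h2
  constructor
  · exact_mod_cast h1.trans (Nat.mul_le_mul_right _ (le_max_left _ _))
  · exact_mod_cast h2.trans (Nat.mul_le_mul_right _ (le_max_right _ _))

/-! ### Even Artin groups -/

theorem altProd_two_mul {G : Type*} [Monoid G] (k : ℕ) (a b : G) :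
    altProd (2 * k) a b = (a * b) ^ k := by
  induction k with
  | zero => rw [pow_zero]; rfl
  | succ k ih =>
    rw [Nat.mul_succ, pow_succ', ← ih, mul_assoc]
    rfl

theorem map_altProd {G H : Type*} [Monoid G] [Monoid H] (f : G →* H) (k : ℕ) (a b : G) :
    f (altProd k a b) = altProd k (f a) (f b) := by
  induction k generalizing a b with
  | zero => exact map_one f
  | succ k ih =>
    change f (a * altProd k b a) = f a * altProd k (f b) (f a)
    rw [map_mul, ih]

namespace ArtinGroup

/-- The standard generator `x_i`. -/
def gen {ι : Type*} (m : CoxeterMatrix ι) (i : ι) : ArtinGroup m := PresentedGroup.of i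

theorem closure_range_gen {ι : Type*} (m : CoxeterMatrix ι) :
    Subgroup.closure (Set.range (gen m)) = ⊤ :=
  PresentedGroup.closure_range_of _

theorem exists_lift {ι : Type*} (m : CoxeterMatrix ι) {G : Type*} [Group G] (f : ι → G)
    (hf : ∀ i j, i ≠ j → altProd (m i j) (f i) (f j) = altProd (m i j) (f j) (f i)) :
    ∃ F : ArtinGroup m →* G, ∀ i, F (gen m i) = f i := by
  refine ⟨PresentedGroup.toGroup (f := f) ?_, fun i => PresentedGroup.toGroup.of _⟩
  rintro r ⟨i, j, hij, rfl⟩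
  rw [map_mul, map_inv, map_altProd, map_altProd, FreeGroup.lift_apply_of,
    FreeGroup.lift_apply_of, m.symmetric j i, hf i j hij, mul_inv_cancel]

theorem altProd_gen {ι : Type*} (m : CoxeterMatrix ι) {i j : ι} (hij : i ≠ j) :
    altProd (m i j) (gen m i) (gen m j) = altProd (m i j) (gen m j) (gen m i) := by
  have h := PresentedGroup.mk_eq_mk_of_mul_inv_mem (rels := {r : FreeGroup ι | ∃ i j : ι, i ≠ j ∧
    r = altProd (m i j) (FreeGroup.of i) (FreeGroup.of j) *
      (altProd (m j i) (FreeGroup.of j) (FreeGroup.of i))⁻¹}) ⟨i, j, hij, rfl⟩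
  rw [map_altProd, map_altProd, m.symmetric j i] at h
  exact h

/-- The label `∞` is covered by `k = 0`, where `(ab)^k = (ba)^k` is vacuous. -/
theorem exists_eq_two_mul {ι : Type*} {m : CoxeterMatrix ι} (heven : IsEvenArtin m) {i j : ι}
    (hij : i ≠ j) : ∃ k, m i j = 2 * k := by
  rcases heven i j hij with h | h
  · exact ⟨0, h⟩
  · exact h.exists_two_nsmul.imp fun k hk => by rw [hk, smul_eq_mul]

/-- The exponent sum of the generator `x_i`, which is well defined if the labels are even. -/
theorem exists_exponent {ι : Type*} {m : CoxeterMatrix ι} (heven : IsEvenArtin m) (i : ι) :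
    ∃ e : ArtinGroup m →* Multiplicative ℤ,
      e (gen m i) = Multiplicative.ofAdd 1 ∧ ∀ j, j ≠ i → e (gen m j) = 1 := by
  classical
  obtain ⟨e, he⟩ := exists_lift m
    (fun j => if j = i then Multiplicative.ofAdd (1 : ℤ) else 1) (fun j k hjk => by
      obtain ⟨n, hn⟩ := exists_eq_two_mul heven hjk
      rw [hn, altProd_two_mul, altProd_two_mul, mul_comm])
  exact ⟨e, by rw [he, if_pos rfl], fun j hj => by rw [he, if_neg hj]⟩

/-- The subgroup generated by `x_i` and `x_j`. -/
def edgeSubgroup {ι : Type*} (m : CoxeterMatrix ι) (i j : ι) : Subgroup (ArtinGroup m) :=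
  Subgroup.closure {gen m i, gen m j}

theorem gen_mem_left {ι : Type*} (m : CoxeterMatrix ι) (i j : ι) :
    gen m i ∈ edgeSubgroup m i j := Subgroup.subset_closure (by simp)

theorem gen_mem_right {ι : Type*} (m : CoxeterMatrix ι) (i j : ι) :
    gen m j ∈ edgeSubgroup m i j := Subgroup.subset_closure (by simp)

theorem edgeSubgroup_fg {ι : Type*} (m : CoxeterMatrix ι) (i j : ι) :
    (edgeSubgroup m i j).FG := by
  classical
  exact ⟨{gen m i, gen m j}, by simp [edgeSubgroup]⟩

/-- Killing the other generators retracts an even Artin group onto `⟨x_i, x_j⟩`. -/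
theorem exists_retraction {ι : Type*} {m : CoxeterMatrix ι} (heven : IsEvenArtin m) (i j : ι) :
    ∃ r : ArtinGroup m →* edgeSubgroup m i j, ∀ h : edgeSubgroup m i j, r h = h := by
  classical
  let f : ι → edgeSubgroup m i j := fun k =>
    if h : gen m k ∈ edgeSubgroup m i j then ⟨gen m k, h⟩ else 1
  obtain ⟨r, hr⟩ := exists_lift m f (fun k l hkl => by
    obtain ⟨n, hn⟩ := exists_eq_two_mul heven hkl
    -- If both generators survive, the relation is inherited; if one is killed, both sides are the
    -- same power of the other's image.
    have hrel := altProd_gen m hkl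
    rw [hn, altProd_two_mul, altProd_two_mul] at hrel ⊢
    by_cases hk : gen m k ∈ edgeSubgroup m i j
    · by_cases hl : gen m l ∈ edgeSubgroup m i j
      · simp only [f, dif_pos hk, dif_pos hl]
        exact Subtype.ext (by simpa using hrel)
      · simp only [f, dif_neg hl, mul_one, one_mul]
    · simp only [f, dif_neg hk, mul_one, one_mul])
  refine ⟨r, ?_⟩
  have hle : edgeSubgroup m i j ≤
      ((edgeSubgroup m i j).subtype.comp r).eqLocus (MonoidHom.id _) := by
    refine (Subgroup.closure_le _).2 ?_
    intro g hg
    have hg' : g ∈ edgeSubgroup m i j := Subgroup.subset_closure hg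
    rcases hg with rfl | rfl
    · change ((r (gen m i) : edgeSubgroup m i j) : ArtinGroup m) = gen m i
      rw [hr]
      simp only [f, dif_pos hg']
    · change ((r (gen m j) : edgeSubgroup m i j) : ArtinGroup m) = gen m j
      rw [hr]
      simp only [f, dif_pos hg']
  exact fun h => Subtype.ext (hle h.2)

theorem isUnconstricted_edgeSubgroup {ι : Type*} {m : CoxeterMatrix ι} (heven : IsEvenArtin m)
    {i j : ι} (hij : (artinGraph m).Adj i j) : IsUnconstrictedGroup (edgeSubgroup m i j) := by
  obtain ⟨k, hk⟩ := exists_eq_two_mul heven hij.1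
  have hk0 : k ≠ 0 := fun h => hij.2 (by rw [hk, h])
  obtain ⟨ei, hei, hei'⟩ := exists_exponent heven i
  obtain ⟨ej, hej, hej'⟩ := exists_exponent heven j
  have hrel := altProd_gen m hij.1
  rw [hk, altProd_two_mul, altProd_two_mul] at hrel
  -- Always `x (yx)^k = (xy)^k x`; the relation replaces `(yx)^k` by `(xy)^k`, so the latter
  -- commutes with `x`.
  have hswap : ∀ x y : ArtinGroup m, (x * y) ^ k = (y * x) ^ k → x * (x * y) ^ k =
      (x * y) ^ k * x := fun x y h => by
    nth_rewrite 1 [h]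
    exact (SemiconjBy.pow_right (show SemiconjBy x (y * x) (x * y) from
      (mul_assoc x y x).symm) k).eq
  have hcen : ∀ g ∈ edgeSubgroup m i j, (gen m i * gen m j) ^ k * g =
      g * (gen m i * gen m j) ^ k := by
    have hle : edgeSubgroup m i j ≤ Subgroup.centralizer {(gen m i * gen m j) ^ k} := by
      rw [edgeSubgroup, Subgroup.closure_le]
      rintro g (rfl | rfl)
      · exact Subgroup.mem_centralizer_singleton_iff.2 (hswap _ _ hrel)
      · refine Subgroup.mem_centralizer_singleton_iff.2 ?_
        rw [hrel]
        exact hswap _ _ hrel.symm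
    exact fun g hg => (Subgroup.mem_centralizer_singleton_iff.1 (hle hg)).symm
  refine isUnconstrictedGroup_of_central ((Group.fg_iff_subgroup_fg _).2 (edgeSubgroup_fg m i j))
    (ei.comp (edgeSubgroup m i j).subtype) ((ei / ej).comp (edgeSubgroup m i j).subtype)
    ⟨(gen m i * gen m j) ^ k, pow_mem (mul_mem (gen_mem_left m i j) (gen_mem_right m i j)) k⟩
    ⟨gen m i, gen_mem_left m i j⟩ (fun g => Subtype.ext (hcen g g.2)) ?_ ?_ ?_
  · change ei ((gen m i * gen m j) ^ k) ≠ 1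
    rw [map_pow, map_mul, hei, hei' j hij.1.symm, mul_one, ← ofAdd_nsmul]
    simpa using hk0
  · change ei ((gen m i * gen m j) ^ k) / ej ((gen m i * gen m j) ^ k) = 1
    rw [map_pow, map_mul, map_pow, map_mul, hei, hei' j hij.1.symm, hej, hej' i hij.1, mul_one,
      one_mul, div_self']
  · change ei (gen m i) / ej (gen m i) ≠ 1
    rw [hei, hej' i hij.1, div_one]
    decide

theorem infinite_inter {ι : Type*} {m : CoxeterMatrix ι} (heven : IsEvenArtin m) {i : ι}
    {H K : Subgroup (ArtinGroup m)} (hH : gen m i ∈ H) (hK : gen m i ∈ K) :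
    ((H : Set (ArtinGroup m)) ∩ (K : Set (ArtinGroup m))).Infinite := by
  obtain ⟨e, he, -⟩ := exists_exponent heven i
  have hinj : Function.Injective fun n : ℕ => gen m i ^ n := by
    intro a b hab
    have h : e (gen m i ^ a) = e (gen m i ^ b) := congrArg e hab
    rw [map_pow, map_pow, he, ← ofAdd_nsmul, ← ofAdd_nsmul] at h
    simpa using h
  refine (Set.infinite_range_of_injective hinj).mono ?_
  rintro _ ⟨n, rfl⟩
  exact ⟨pow_mem hH n, pow_mem hK n⟩

/-- The subgroups generated by the pairs of adjacent standard generators. -/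
def edgeSubgroups {ι : Type*} (m : CoxeterMatrix ι) : Set (Subgroup (ArtinGroup m)) :=
  {H | ∃ i j, (artinGraph m).Adj i j ∧ H = edgeSubgroup m i j}

/-- Induction on a walk from `j` to `k`: consecutive edges share a vertex, whose generator lies in
both subgroups. -/
theorem thickly_connected {ι : Type*} {m : CoxeterMatrix ι} (heven : IsEvenArtin m) {j k : ι}
    (h : (artinGraph m).Reachable j k) {i l : ι} (hij : (artinGraph m).Adj i j)
    (hkl : (artinGraph m).Adj k l) : Relation.ReflTransGen
    (fun K K' => K ∈ edgeSubgroups m ∧ K' ∈ edgeSubgroups m ∧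
      ((K : Set (ArtinGroup m)) ∩ (K' : Set (ArtinGroup m))).Infinite)
    (edgeSubgroup m i j) (edgeSubgroup m k l) := by
  obtain ⟨w⟩ := h
  induction w generalizing i with
  | nil =>
    exact Relation.ReflTransGen.single ⟨⟨_, _, hij, rfl⟩, ⟨_, _, hkl, rfl⟩,
      infinite_inter heven (gen_mem_right m _ _) (gen_mem_left m _ _)⟩
  | cons hadj _ ih =>
    exact Relation.ReflTransGen.head ⟨⟨_, _, hij, rfl⟩, ⟨_, _, hadj, rfl⟩,
      infinite_inter heven (gen_mem_right m _ _) (gen_mem_left m _ _)⟩ (ih hadj hkl)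

theorem isAlgebraicNetwork {ι : Type*} [Finite ι] [Nontrivial ι] {m : CoxeterMatrix ι}
    (heven : IsEvenArtin m) (hconn : (artinGraph m).Connected) (S : FinGenSet (ArtinGroup m)) :
    IsAlgebraicNetwork S 1 (edgeSubgroups m) where
  finite := by
    refine (Set.finite_range fun p : ι × ι => edgeSubgroup m p.1 p.2).subset ?_
    rintro _ ⟨i, j, -, rfl⟩
    exact ⟨(i, j), rfl⟩
  nonempty := by
    obtain ⟨i⟩ := hconn.nonempty
    -- With at least two vertices, connectedness leaves no vertex isolated.
    obtain ⟨j, hij⟩ := hconn.preconnected.exists_adj_of_nontrivial i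
    exact ⟨_, i, j, hij, rfl⟩
  fg := by
    rintro _ ⟨i, j, -, rfl⟩
    exact edgeSubgroup_fg m i j
  undistorted := by
    rintro _ ⟨i, j, -, rfl⟩
    obtain ⟨r, hr⟩ := exists_retraction heven i j
    exact isUndistorted_of_retraction _ r hr
  exists_finiteIndex := by
    -- The finite index subgroup is the whole group, so all distances to it are `0` and `M = 1`
    -- suffices.
    refine ⟨⊤, inferInstance, fun g => ⟨g, Subgroup.mem_top g, ?_⟩, Set.range (gen m),
      Set.finite_range _, closure_range_gen m, ?_⟩
    · exact (dist_self (α := WordSpace S) g).trans_lt one_pos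
    · rintro _ ⟨i, rfl⟩
      obtain ⟨j, hij⟩ := hconn.preconnected.exists_adj_of_nontrivial i
      exact Set.mem_biUnion (show edgeSubgroup m i j ∈ edgeSubgroups m from ⟨i, j, hij, rfl⟩)
        (gen_mem_left m i j)
  thickly_connected := by
    rintro _ ⟨i, j, hij, rfl⟩ _ ⟨k, l, hkl, rfl⟩
    exact thickly_connected heven (hconn.preconnected j k) hij hkl

end ArtinGroup

theorem mainTheorem12 {ι : Type*} [Finite ι] [Nontrivial ι] (m : CoxeterMatrix ι)
    (heven : IsEvenArtin m) (hconn : (artinGraph m).Connected) :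
    IsAlgThickOfOrderAtMost 1 (ArtinGroup m) := by
  refine ⟨?_, ArtinGroup.edgeSubgroups m,
    fun S => ⟨1, one_pos, ArtinGroup.isAlgebraicNetwork heven hconn S⟩, ?_⟩
  · exact Group.fg_iff.2 ⟨_, ArtinGroup.closure_range_gen m, Set.finite_range _⟩
  · rintro _ ⟨i, j, hij, rfl⟩
    exact ArtinGroup.isUnconstricted_edgeSubgroup heven hij
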